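/- **Setting.** Let $F,G$ be finite groups, $X,Y,Z$ finite sets, and suppose that $G$ acts transitively on $X$ and on $Z$ and $F$ acts transitively on $Y$. All representations are complex, finite-dimensional and unitary. For a finite set $A$, $L(A)$ is the space of functions $A\to\mathbb C$ with $\langle f_1,f_2\rangle=\sum_{a\in A}f_1(a)\overline{f_2(a)}$; if a group $H$ acts on $A$, it acts on $L(A)$ by $(hf)(a)=f(h^{-1}a)$. Spaces of linear operators carry the Hilbert–Schmidt scalar product $\langle S,T\rangle_{HS}=\sum_k\langle Su_k,Tu_k\rangle$ ($u_1,\dots,u_n$ an orthonormal basis of the domain), and $\mathrm{Hom}_H$ denotes the space of $H$-intertwining operators. Let $(\sigma_i,V_i)_i$ be pairwise inequivalent irreducible representations of $F$, let $X=\coprod_i\Omega_i$, and set $\sigma_x=\sigma_i$, $V_{\sigma_x}=V_i$ for $x\in\Omega_i$. Assume that every $\sigma_x$ occurs in $L(Y)$. Let $I=\{g\in G:\sigma_{gx}\sim\sigma_x\ \forall x\in X\}$ (so $gx$ and $x$ lie in the same block for all $g\in I$, $x\in X$), and let $F\wr I=F^X\rtimes I$ with $(f,g)(f',g')=(x\mapsto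 f(x)f'(g^{-1}x),\,gg')$. The group $F\wr I$ acts - on $Y^X\times Z$ by $(f,g)(\varphi,z)=(x\mapsto f(x)\varphi(g^{-1}x),\,gz)$; - on $\bigotimes_{x\in X}V_{\sigma_x}$ by $\widetilde\sigma(f,g)\bigl(\bigotimes_xv_x\bigr)=\bigotimes_x\sigma_x(f(x))v_{g^{-1}x}$. Let $(\eta,U)$ be an irreducible representation of $I$, let $\overline\eta(f,g)=\eta(g)$ be its inflation to $F\wr I$, and let $F\wr I$ act on $\bigl(\bigotimes_xV_{\sigma_x}\bigr)\otimes U$ by $\widetilde\sigma\otimes\overline\eta$. For each $i$ let $m_i=\dim\mathrm{Hom}_F(V_i,L(Y))$ and fix an orthonormal basis $T_{i,1},\dots,T_{i,m_i}$ of $\mathrm{Hom}_F(V_i,L(Y))$; put $T_{x,h}=T_{i,h}$ for $x\in\Omega_i$. Let $J$ be the set of all functions $j$ on $X$ with $j(x)\in\{1,\dots,m_i\}$ for $x\in\Omega_i$; $I$ acts on $J$ by $(gj)(x)=j(g^{-1}x)$, and diagonally on $Z\times J$. For $j\in J$ let $T_j=\bigotimes_{x}T_{x,j(x)}:\bigotimes_xV_{\sigma_x}\to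 L(Y^X)$ be the linear operator with $\bigl(T_j\bigotimes_xv_x\bigr)(\varphi)=\prod_{x\in X}(T_{x,j(x)}v_x)(\varphi(x))$. **Theorem.** For $\mathcal T\in\mathrm{Hom}_I(U,L(Z\times J))$, the formula $$[\widehat{\mathcal T}(v\otimes u)](\varphi,z)=\sum_{j\in J}(\mathcal Tu)(z,j)\,(T_jv)(\varphi),\qquad v=\bigotimes_{x\in X}v_x,\ u\in U,\ (\varphi,z)\in Y^X\times Z,$$ defines an operator $\widehat{\mathcal T}\in\mathrm{Hom}_{F\wr I}\bigl((\bigotimes_{x\in X}V_{\sigma_x})\otimes U,\;L(Y^X\times Z)\bigr)$, and the map $\mathcal T\mapsto\widehat{\mathcal T}$ is a linear isometric isomorphism (for the Hilbert–Schmidt scalar products) of $\mathrm{Hom}_I(U,L(Z\times J))$ onto $\mathrm{Hom}_{F\wr I}\bigl((\bigotimes_{x\in X}V_{\sigma_x})\otimes U,\;L(Y^X\times Z)\bigr)$. -/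

import Mathlib

open scoped TensorProduct

namespace WreathRep

noncomputable section

/-! ### Unitary representations, permutation representations, Hilbert-Schmidt product -/

/-- The representation `ρ` acts by unitary operators. -/
def IsUnitary {G V : Type*} [Group G] [NormedAddCommGroup V] [InnerProductSpace ℂ V]
    (ρ : Representation ℂ G V) : Prop :=
  ∀ (g : G) (v w : V), inner ℂ (ρ g v) (ρ g w) = inner ℂ v w

/-- `L(A)`: the complex valued functions on the finite set `A`, with the scalar product
`∑ a, f₁ a * conj (f₂ a)` (up to the order of the two arguments). -/
abbrev L (A : Type*) := EuclideanSpace ℂ A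

/-- The permutation representation of `H` on `L(A)`: `(h ψ)(a) = ψ (h⁻¹ a)`. -/
def permRep (H A : Type*) [Group H] [MulAction H A] : Representation ℂ H (L A) where
  toFun h :=
    { toFun := fun ψ => WithLp.toLp 2 fun a => ψ (h⁻¹ • a)
      map_add' := fun _ _ => rfl
      map_smul' := fun _ _ => rfl }
  map_one' := by ext ψ a; simp
  map_mul' h k := by
    ext ψ a
    change ψ ((h * k)⁻¹ • a) = ψ (k⁻¹ • h⁻¹ • a)
    simp [mul_smul]

@[simp]
theorem permRep_apply {H A : Type*} [Group H] [MulAction H A] (h : H) (ψ : L A) (a : A) :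
    permRep H A h ψ a = ψ (h⁻¹ • a) := rfl

/-- The Hilbert-Schmidt scalar product of two operators, `∑ k, ⟨S u_k, T u_k⟩` for an orthonormal
basis `u` of the domain. -/
def hsInner {V W : Type*} [NormedAddCommGroup V] [InnerProductSpace ℂ V] [FiniteDimensional ℂ V]
    [NormedAddCommGroup W] [InnerProductSpace ℂ W] (S T : V →ₗ[ℂ] W) : ℂ :=
  ∑ k, inner ℂ (S (stdOrthonormalBasis ℂ V k)) (T (stdOrthonormalBasis ℂ V k))

/-- The Hilbert-Schmidt scalar product may be computed in any orthonormal basis. -/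
theorem hsInner_eq_sum {V W κ : Type*} [NormedAddCommGroup V] [InnerProductSpace ℂ V]
    [FiniteDimensional ℂ V] [NormedAddCommGroup W] [InnerProductSpace ℂ W] [FiniteDimensional ℂ W]
    [Fintype κ] (b : OrthonormalBasis κ ℂ V) (S T : V →ₗ[ℂ] W) :
    hsInner S T = ∑ k, inner ℂ (S (b k)) (T (b k)) := by
  have h : ∀ {μ : Type _} [Fintype μ] (a : OrthonormalBasis μ ℂ V),
      ∑ k, inner ℂ (S (a k)) (T (a k)) =
        LinearMap.trace ℂ V (LinearMap.adjoint S ∘ₗ T) := by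
    intro μ _ a
    rw [LinearMap.trace_eq_sum_inner _ a]
    simp [LinearMap.adjoint_inner_right]
  have h' : ∑ k, inner ℂ (S (b k)) (T (b k)) =
      LinearMap.trace ℂ V (LinearMap.adjoint S ∘ₗ T) := by
    rw [LinearMap.trace_eq_sum_inner _ b]
    simp [LinearMap.adjoint_inner_right]
  rw [h', hsInner, h]

/-! ### The Hermitian tensor product of a finite family -/

section Tensor

variable {X : Type*} [Fintype X] [DecidableEq X]

/-- `⊗_x V_x`. This is `PiTensorProduct` under a new name, because `PiTensorProduct` carries a
seminorm in Mathlib that is not the one of the Hermitian tensor product. -/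
def TensorSpace {X : Type*} (V : X → Type*) [∀ x, NormedAddCommGroup (V x)]
    [∀ x, InnerProductSpace ℂ (V x)] : Type _ := ⨂[ℂ] x, V x

variable (V : X → Type*) [∀ x, NormedAddCommGroup (V x)] [∀ x, InnerProductSpace ℂ (V x)]

instance : AddCommGroup (TensorSpace V) := inferInstanceAs (AddCommGroup (⨂[ℂ] x, V x))

instance : Module ℂ (TensorSpace V) := inferInstanceAs (Module ℂ (⨂[ℂ] x, V x))

variable {V} in
/-- The pure tensor `⊗_x v_x`. -/
def pureTensor (v : ∀ x, V x) : TensorSpace V := PiTensorProduct.tprod ℂ v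

variable [∀ x, FiniteDimensional ℂ (V x)]

instance : FiniteDimensional ℂ (TensorSpace V) :=
  inferInstanceAs (Module.Finite ℂ (⨂[ℂ] x, V x))

/-- The basis of `⊗_x V_x` formed by the pure tensors of the vectors of orthonormal bases. -/
def tensorBasis :
    Module.Basis (∀ x, Fin (Module.finrank ℂ (V x))) ℂ (TensorSpace V) :=
  Basis.piTensorProduct fun x => (stdOrthonormalBasis ℂ (V x)).toBasis

/-- The scalar product of `⊗_x V_x`, for which `tensorBasis` is orthonormal; on pure tensors it is
the product of the scalar products, see `inner_pureTensor`. -/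
@[reducible]
def tensorCore : InnerProductSpace.Core ℂ (TensorSpace V) where
  inner s t := ∑ p, star ((tensorBasis V).repr s p) * (tensorBasis V).repr t p
  conj_inner_symm s t := by
    simp [map_sum, mul_comm]
  re_inner_nonneg s := by
    simp only [map_sum]
    refine Finset.sum_nonneg fun p _ => ?_
    rw [mul_comm]
    simp [Complex.mul_conj, Complex.normSq_nonneg]
  add_left s t r := by simp [add_mul, Finset.sum_add_distrib]
  smul_left s t a := by simp [Finset.mul_sum, mul_assoc]
  definite s h := by
    have h2 : ∑ p, Complex.normSq ((tensorBasis V).repr s p) = 0 := by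
      have : ((∑ p, Complex.normSq ((tensorBasis V).repr s p) : ℝ) : ℂ) = 0 := by
        rw [← h]
        push_cast
        refine Finset.sum_congr rfl fun p _ => ?_
        rw [mul_comm, Complex.normSq_eq_conj_mul_self, mul_comm]
        rfl
      exact_mod_cast this
    rw [Finset.sum_eq_zero_iff_of_nonneg fun p _ => Complex.normSq_nonneg _] at h2
    refine (tensorBasis V).ext_elem fun p => ?_
    simpa using h2 p (Finset.mem_univ p)

instance : NormedAddCommGroup (TensorSpace V) := (tensorCore V).toNormedAddCommGroup

instance : InnerProductSpace ℂ (TensorSpace V) := .ofCore (tensorCore V).toCore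

variable {V} in
/-- `⟨⊗ v_x, ⊗ w_x⟩ = ∏ ⟨v_x, w_x⟩`. -/
theorem inner_pureTensor (v w : ∀ x, V x) :
    inner ℂ (pureTensor v) (pureTensor w) = ∏ x, inner ℂ (v x) (w x) := by
  change ∑ p, star ((tensorBasis V).repr (pureTensor v) p) *
    (tensorBasis V).repr (pureTensor w) p = _
  have key : ∀ (u : ∀ x, V x) p, (tensorBasis V).repr (pureTensor u) p =
      ∏ x, inner ℂ (stdOrthonormalBasis ℂ (V x) (p x)) (u x) := by
    intro u p
    refine (Basis.piTensorProduct_repr_tprod_apply _ u p).trans ?_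
    simp [OrthonormalBasis.repr_apply_apply]
  simp only [key, star_prod, ← Finset.prod_mul_distrib]
  rw [← Fintype.prod_sum (fun x k => star (inner ℂ (stdOrthonormalBasis ℂ (V x) k) (v x)) *
    inner ℂ (stdOrthonormalBasis ℂ (V x) k) (w x))]
  refine Finset.prod_congr rfl fun x _ => ?_
  rw [← (stdOrthonormalBasis ℂ (V x)).sum_inner_mul_inner (v x) (w x)]
  refine Finset.sum_congr rfl fun k _ => ?_
  rw [← inner_conj_symm (v x)]
  rfl

end Tensor

/-- The operator `⊗_x A_x : ⊗_x V_x → L(Y^X)` built from `A_x : V_x → L(Y)`, where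
`⊗_x ψ_x ∈ L(Y^X)` is the function `φ ↦ ∏ x, ψ_x (φ x)`. -/
def tensorOp {X Y : Type*} [Fintype X] {V : X → Type*} [∀ x, NormedAddCommGroup (V x)]
    [∀ x, InnerProductSpace ℂ (V x)] (A : ∀ x, V x →ₗ[ℂ] L Y) :
    TensorSpace V →ₗ[ℂ] L (X → Y) :=
  (WithLp.linearEquiv 2 ℂ ((X → Y) → ℂ)).symm.toLinearMap ∘ₗ
    LinearMap.pi fun φ : X → Y =>
      (PiTensorProduct.lift ((MultilinearMap.mkPiAlgebra ℂ X ℂ).compLinearMap fun x =>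
        LinearMap.proj (φ x) ∘ₗ (WithLp.linearEquiv 2 ℂ (Y → ℂ)).toLinearMap ∘ₗ A x) :
          (⨂[ℂ] x, V x) →ₗ[ℂ] ℂ)

@[simp]
theorem tensorOp_pureTensor {X Y : Type*} [Fintype X] {V : X → Type*}
    [∀ x, NormedAddCommGroup (V x)] [∀ x, InnerProductSpace ℂ (V x)]
    (A : ∀ x, V x →ₗ[ℂ] L Y) (v : ∀ x, V x) (φ : X → Y) :
    tensorOp A (pureTensor v) φ = ∏ x, A x (v x) (φ x) := by
  refine (PiTensorProduct.lift.tprod (R := ℂ) (s := V) v).trans ?_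
  simp

/-! ### Wreath products and their actions -/

/-- The wreath product `F ≀ G = F^X ⋊ G`, where `G` acts on `F^X` by `(g f)(x) = f (g⁻¹ x)`. -/
abbrev WreathProduct (F G X : Type*) [Group F] [Group G] [MulAction G X] :=
  (X → F) ⋊[(mulAutArrow : G →* MulAut (X → F))] G

/-- The action of `F ≀ G` on `Y^X × Z`, `(f, g) (φ, z) = ((f, g) φ, g z)`, where
`((f, g) φ)(x) = f(x) φ(g⁻¹ x)`. -/
instance wreathAction {F G X Y Z : Type*} [Group F] [Group G] [MulAction G X] [MulAction F Y]
    [MulAction G Z] : MulAction (WreathProduct F G X) ((X → Y) × Z) where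
  smul w p := (fun x => w.left x • p.1 (w.right⁻¹ • x), w.right • p.2)
  one_smul p := by
    refine Prod.ext (funext fun x => ?_) ?_
    · change (1 : F) • p.1 ((1 : G)⁻¹ • x) = p.1 x
      simp
    · exact one_smul G p.2
  mul_smul w w' p := by
    refine Prod.ext (funext fun x => ?_) ?_
    · change (w.left x * w'.left (w.right⁻¹ • x)) • p.1 ((w.right * w'.right)⁻¹ • x) =
        w.left x • w'.left (w.right⁻¹ • x) • p.1 (w'.right⁻¹ • w.right⁻¹ • x)
      simp [mul_smul]
    · exact mul_smul w.right w'.right p.2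

theorem wreath_smul_def {F G X Y Z : Type*} [Group F] [Group G] [MulAction G X] [MulAction F Y]
    [MulAction G Z] (w : WreathProduct F G X) (p : (X → Y) × Z) :
    w • p = (fun x => w.left x • p.1 (w.right⁻¹ • x), w.right • p.2) := rfl

/-! ### The inertia group, the index set `J` and the extended representation

The map `x ↦ σ_x` is given by representations `σ i` on spaces `V i`, pairwise inequivalent, and a
map `c : X → ι`, so that `σ_x = σ (c x)` and the blocks are `Ω_i = c⁻¹(i)`. -/

section Inertia

variable {F G X ι : Type*} [Group F] [Group G] [MulAction G X] {V : ι → Type*}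
  [∀ i, NormedAddCommGroup (V i)] [∀ i, InnerProductSpace ℂ (V i)]

/-- The representations `σ i` are pairwise inequivalent. -/
class PairwiseInequivalent (σ : ∀ i, Representation ℂ F (V i)) : Prop where
  eq_of_equiv : ∀ i k, Nonempty ((σ i).Equiv (σ k)) → i = k

variable (G) in
/-- The inertia group `{g | σ_{gx} ∼ σ_x for all x}`. -/
def inertia (σ : ∀ i, Representation ℂ F (V i)) (c : X → ι) : Subgroup G where
  carrier := {g | ∀ x, Nonempty ((σ (c (g • x))).Equiv (σ (c x)))}
  one_mem' x := by
    rw [one_smul]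
    exact ⟨.refl _⟩
  mul_mem' {g h} hg hh x := by
    obtain ⟨e⟩ := hg (h • x)
    obtain ⟨e'⟩ := hh x
    rw [mul_smul]
    exact ⟨e.trans e'⟩
  inv_mem' {g} hg x := by
    obtain ⟨e⟩ := hg (g⁻¹ • x)
    rw [smul_inv_smul] at e
    exact ⟨e.symm⟩

variable {σ : ∀ i, Representation ℂ F (V i)} [PairwiseInequivalent σ] {c : X → ι}

theorem inertia_apply (g : inertia G σ c) (x : X) : c (g • x) = c x :=
  PairwiseInequivalent.eq_of_equiv (σ := σ) _ _ (g.2 x)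

/-- `J`: the functions `j` on `X` with `j x ∈ {1, …, m_i}` for `x ∈ Ω_i`. -/
def MultiIndex (m : ι → ℕ) (c : X → ι) : Type _ := ∀ x, Fin (m (c x))

instance (m : ι → ℕ) (c : X → ι) [Fintype X] [DecidableEq X] : Fintype (MultiIndex m c) :=
  inferInstanceAs (Fintype (∀ x, Fin (m (c x))))

/-- The action of the inertia group on `J`: `(g j)(x) = j (g⁻¹ x)`. -/
instance multiIndexAction (m : ι → ℕ) : MulAction (inertia G σ c) (MultiIndex m c) where
  smul g j := fun x => Fin.cast (congrArg m (inertia_apply g⁻¹ x)) (j (g⁻¹ • x))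
  one_smul j := by
    funext x
    have h : ∀ y, y = x → ((j y : Fin _) : ℕ) = j x := by rintro _ rfl; rfl
    exact Fin.ext (h ((1 : inertia G σ c)⁻¹ • x) (by simp))
  mul_smul g g' j := by
    funext x
    have h : ∀ y y', y = y' → ((j y : Fin _) : ℕ) = j y' := by rintro _ _ rfl; rfl
    exact Fin.ext (h ((g * g')⁻¹ • x) (g'⁻¹ • g⁻¹ • x) (by simp [mul_smul]))

theorem multiIndex_smul_apply (m : ι → ℕ) (g : inertia G σ c) (j : MultiIndex m c) (x : X) :
    (g • j) x = Fin.cast (congrArg m (inertia_apply g⁻¹ x)) (j (g⁻¹ • x)) := rfl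

variable (V) in
/-- The identity map `V i → V k` for `i = k`. -/
def idOfEq {i k : ι} (h : i = k) : V i →ₗ[ℂ] V k := (LinearEquiv.cast (R := ℂ) h).toLinearMap

variable (c) in
/-- The operator `⊗ v_x ↦ ⊗ σ_x(f x) v_{g⁻¹ x}`. -/
def extOp (w : WreathProduct F (inertia G σ c) X) :
    TensorSpace (fun x => V (c x)) →ₗ[ℂ] TensorSpace (fun x => V (c x)) :=
  (PiTensorProduct.map (R := ℂ) (s := fun x => V (c (w.right⁻¹ • x))) (t := fun x => V (c x))
    fun x => σ (c x) (w.left x) ∘ₗ idOfEq V (inertia_apply w.right⁻¹ x)) ∘ₗ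
  ((PiTensorProduct.reindex ℂ (fun x => V (c x)) (MulAction.toPerm w.right)).toLinearMap :
    (⨂[ℂ] x, V (c x)) →ₗ[ℂ] ⨂[ℂ] x, V (c (w.right⁻¹ • x)))

theorem extOp_pureTensor (w : WreathProduct F (inertia G σ c) X) (v : ∀ x, V (c x)) :
    extOp c w (pureTensor v) = pureTensor fun x =>
      σ (c x) (w.left x) (idOfEq V (inertia_apply w.right⁻¹ x) (v (w.right⁻¹ • x))) := by
  have h : (PiTensorProduct.reindex ℂ (fun x => V (c x)) (MulAction.toPerm w.right)
      (PiTensorProduct.tprod ℂ v) : ⨂[ℂ] x, V (c (w.right⁻¹ • x))) =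
      PiTensorProduct.tprod ℂ fun x => v (w.right⁻¹ • x) :=
    PiTensorProduct.reindex_tprod (R := ℂ) (s := fun x => V (c x)) (MulAction.toPerm w.right) v
  refine (congrArg (PiTensorProduct.map (R := ℂ) (s := fun x => V (c (w.right⁻¹ • x)))
    (t := fun x => V (c x)) fun x =>
      σ (c x) (w.left x) ∘ₗ idOfEq V (inertia_apply w.right⁻¹ x)) h).trans ?_
  exact PiTensorProduct.map_tprod _ _

variable (G σ c) in
/-- The extension `σ̃` of `⊗_x σ_x` to `F ≀ I`, with `I` the inertia group:
`σ̃(f, g) (⊗ v_x) = ⊗ σ_x(f x) v_{g⁻¹ x}`. -/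
def extRep : Representation ℂ (WreathProduct F (inertia G σ c) X)
    (TensorSpace fun x => V (c x)) where
  toFun := extOp c
  map_one' := by
    refine PiTensorProduct.ext (MultilinearMap.ext fun v => ?_)
    refine (extOp_pureTensor 1 v).trans (congrArg pureTensor (funext fun x => ?_))
    have h : ∀ y (hy : y = x) (h' : c y = c x), idOfEq V h' (v y) = v x := by
      rintro _ rfl h'; rfl
    change σ (c x) 1 (idOfEq V _ (v ((1 : inertia G σ c)⁻¹ • x))) = v x
    rw [map_one]
    exact h _ (by simp) (inertia_apply (1 : inertia G σ c)⁻¹ x)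
  map_mul' w w' := by
    refine PiTensorProduct.ext (MultilinearMap.ext fun v => ?_)
    refine (extOp_pureTensor (w * w') v).trans (Eq.symm ?_)
    refine ((congrArg (extOp c w) (extOp_pureTensor w' v)).trans
      (extOp_pureTensor w _)).trans (congrArg pureTensor (funext fun x => ?_))
    have h1 : ∀ i k (h : i = k) (a : F) (u : V i),
        idOfEq V h (σ i a u) = σ k a (idOfEq V h u) := by rintro _ _ rfl a u; rfl
    have h2 : ∀ y y' (_ : y = y') i (h : c y = i) (h' : i = c x) (h'' : c y' = c x),
        idOfEq V h' (idOfEq V h (v y)) = idOfEq V h'' (v y') := by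
      rintro y _ rfl _ rfl h' h''; rfl
    rw [h1, ← Module.End.mul_apply, ← map_mul]
    congr 1
    exact h2 _ _ (by simp [mul_smul]) _ _ _ _

theorem extRep_pureTensor (w : WreathProduct F (inertia G σ c) X) (v : ∀ x, V (c x)) :
    extRep G σ c w (pureTensor v) = pureTensor fun x =>
      σ (c x) (w.left x) (idOfEq V (inertia_apply w.right⁻¹ x) (v (w.right⁻¹ • x))) :=
  extOp_pureTensor w v

/-- The inflation of a representation of `H` to `F ≀ H`: `η̄(f, g) = η(g)`. -/
def inflation {H U : Type*} [Group H] [MulAction H X] [AddCommGroup U] [Module ℂ U]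
    (η : Representation ℂ H U) : Representation ℂ (WreathProduct F H X) U :=
  η.comp SemidirectProduct.rightHom

end Inertia

end

end WreathRep

open WreathRep

/-! Everything rests on the operators `T_j` being an orthonormal basis of the space of
`F^X`-intertwiners from `⊗_x V_{σ_x}` to `L(Y^X)`. Orthonormality holds because Hilbert–Schmidt
products of decomposable operators multiply over `x` (`hsInner_tensorOp`). Spanning follows by
averaging: an intertwiner equals its mean over `F^X`, and the mean of a decomposable operator is
again decomposable, with factors in `Hom_F(V_{σ_x}, L(Y))` (`eq_sum_tensorOp_of_intertwining`).

The formula for the lifted operator makes sense for any linear `S : U → L(Z × J)`; this is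
`kernelOp`. Orthonormality of the `T_j` makes it isometric, hence injective. Its image contains
every operator whose slices (fixed `u` and `z`) lie in the span of the `T_j`, and the slices of an
intertwiner do, since `F^X` acts only on the first factors. Finally, conjugating `kernelOp S` by
`(f, g)` amounts to conjugating `S` by `g` (`conj_kernelOp`), so by injectivity `kernelOp S`
intertwines `F ≀ I` exactly when `S` intertwines `I`. -/

namespace WreathRep

open Representation

/-! ### Hilbert–Schmidt products -/

section HilbertSchmidt

variable {V W : Type*} [NormedAddCommGroup V] [InnerProductSpace ℂ V] [FiniteDimensional ℂ V]
  [NormedAddCommGroup W] [InnerProductSpace ℂ W]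

theorem hsInner_self_eq_zero {S : V →ₗ[ℂ] W} (h : hsInner S S = 0) : S = 0 := by
  have h1 : ∑ k, ‖S (stdOrthonormalBasis ℂ V k)‖ ^ 2 = 0 := by
    have h2 : ((∑ k, ‖S (stdOrthonormalBasis ℂ V k)‖ ^ 2 : ℝ) : ℂ) = 0 := by
      rw [← h, hsInner]
      push_cast
      refine Finset.sum_congr rfl fun k _ => Eq.symm ?_
      exact inner_self_eq_norm_sq_to_K (𝕜 := ℂ) (S (stdOrthonormalBasis ℂ V k))
    exact_mod_cast h2
  rw [Finset.sum_eq_zero_iff_of_nonneg fun k _ => by positivity] at h1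
  refine (stdOrthonormalBasis ℂ V).toBasis.ext fun k => ?_
  simpa using h1 k (Finset.mem_univ k)

theorem hsInner_add_right (R S T : V →ₗ[ℂ] W) : hsInner R (S + T) = hsInner R S + hsInner R T := by
  simp [hsInner, Finset.sum_add_distrib]

theorem hsInner_smul_right (a : ℂ) (R S : V →ₗ[ℂ] W) : hsInner R (a • S) = a * hsInner R S := by
  simp [hsInner, Finset.mul_sum]

theorem hsInner_sum_right {κ : Type*} (s : Finset κ) (R : V →ₗ[ℂ] W) (S : κ → V →ₗ[ℂ] W) :
    hsInner R (∑ j ∈ s, S j) = ∑ j ∈ s, hsInner R (S j) := by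
  simp only [hsInner, LinearMap.sum_apply, inner_sum]
  rw [Finset.sum_comm]

theorem hsInner_L {A : Type*} [Fintype A] (S T : V →ₗ[ℂ] L A) :
    hsInner S T = ∑ k, ∑ a, star (S (stdOrthonormalBasis ℂ V k) a) *
      T (stdOrthonormalBasis ℂ V k) a := by
  refine Finset.sum_congr rfl fun k _ => ?_
  rw [PiLp.inner_apply]
  refine Finset.sum_congr rfl fun a _ => ?_
  rw [mul_comm]; rfl

end HilbertSchmidt

theorem prod_ite_eq_ite {X : Type*} [Fintype X] {κ : X → Type*} [∀ x, DecidableEq (κ x)]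
    (j k : ∀ x, κ x) [Decidable (j = k)] :
    (∏ x, if j x = k x then (1 : ℂ) else 0) = if j = k then 1 else 0 := by
  rw [Finset.prod_ite_zero]
  simp [funext_iff]

/-! ### Decomposable operators on tensor products -/

section Tensor

variable {X : Type*} {V : X → Type*}
  [∀ x, NormedAddCommGroup (V x)] [∀ x, InnerProductSpace ℂ (V x)]

theorem tensorSpace_ext {W : Type*} [AddCommGroup W] [Module ℂ W] {A B : TensorSpace V →ₗ[ℂ] W}
    (h : ∀ v, A (pureTensor v) = B (pureTensor v)) : A = B :=
  PiTensorProduct.ext (MultilinearMap.ext h)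

variable [Fintype X] [∀ x, FiniteDimensional ℂ (V x)]

theorem tensorBasis_apply (p : ∀ x, Fin (Module.finrank ℂ (V x))) :
    tensorBasis V p = pureTensor fun x => stdOrthonormalBasis ℂ (V x) (p x) := by
  refine (Basis.piTensorProduct_apply _ p).trans ?_
  simp [pureTensor]

variable [DecidableEq X]

theorem orthonormal_tensorBasis : Orthonormal ℂ (tensorBasis V) := by
  classical
  rw [orthonormal_iff_ite]
  intro p q
  simp only [tensorBasis_apply, inner_pureTensor, OrthonormalBasis.inner_eq_ite]
  exact prod_ite_eq_ite p q

theorem hsInner_tensor {W : Type*} [NormedAddCommGroup W] [InnerProductSpace ℂ W]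
    [FiniteDimensional ℂ W] (A B : TensorSpace V →ₗ[ℂ] W) :
    hsInner A B = ∑ p : ∀ x, Fin (Module.finrank ℂ (V x)),
      inner ℂ (A (pureTensor fun x => stdOrthonormalBasis ℂ (V x) (p x)))
        (B (pureTensor fun x => stdOrthonormalBasis ℂ (V x) (p x))) := by
  rw [hsInner_eq_sum ((tensorBasis V).toOrthonormalBasis orthonormal_tensorBasis)]
  simp [tensorBasis_apply]

/-- The Hilbert-Schmidt scalar product of two decomposable operators is the product of those of
the factors. -/
theorem hsInner_tensorOp {Y : Type*} [Fintype Y] (A B : ∀ x, V x →ₗ[ℂ] L Y) :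
    hsInner (tensorOp A) (tensorOp B) = ∏ x, hsInner (A x) (B x) := by
  classical
  rw [hsInner_tensor]
  simp only [hsInner_L, PiLp.inner_apply, tensorOp_pureTensor]
  -- The product over `x` of double sums expands twice: over basis vectors, giving the tensor basis,
  -- and over points of `Y`, giving `Y^X`.
  rw [Fintype.prod_sum]
  refine Finset.sum_congr rfl fun p _ => ?_
  rw [Fintype.prod_sum]
  refine Finset.sum_congr rfl fun φ _ => ?_
  rw [Finset.prod_mul_distrib, mul_comm, ← star_prod]
  rfl

/-- The operator `v ↦ ⟨e_k, v⟩ δ_y`. -/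
noncomputable def matrixUnit {W Y : Type*} [NormedAddCommGroup W] [InnerProductSpace ℂ W]
    [FiniteDimensional ℂ W] (k : Fin (Module.finrank ℂ W)) (y : Y) : W →ₗ[ℂ] L Y :=
  open Classical in
  LinearMap.toSpanSingleton ℂ (L Y) (WithLp.toLp 2 (Pi.single y 1)) ∘ₗ
    (stdOrthonormalBasis ℂ W).toBasis.coord k

theorem matrixUnit_apply {W Y : Type*} [NormedAddCommGroup W] [InnerProductSpace ℂ W]
    [FiniteDimensional ℂ W] [DecidableEq Y] (k l : Fin (Module.finrank ℂ W)) (y z : Y) :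
    matrixUnit k y (stdOrthonormalBasis ℂ W l) z = if k = l ∧ y = z then 1 else 0 := by
  have : matrixUnit k y (stdOrthonormalBasis ℂ W l) z =
    (if k = l then 1 else 0) * (Pi.single (M := fun _ => ℂ) y 1 z : ℂ) := by
    by_cases h : k = l <;>
      simp [matrixUnit, Pi.single_apply, h]
  rw [this, Pi.single_apply]
  by_cases h : k = l <;> simp [h, eq_comm]

/-- Decomposable operators span the space of all operators. -/
theorem eq_sum_tensorOp {Y : Type*} [Fintype Y] (B : TensorSpace V →ₗ[ℂ] L (X → Y)) :
    B = ∑ p : ∀ x, Fin (Module.finrank ℂ (V x)), ∑ ψ : X → Y,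
      B (tensorBasis V p) ψ • tensorOp fun x => matrixUnit (p x) (ψ x) := by
  classical
  refine (tensorBasis V).ext fun q => ?_
  ext φ
  simp only [LinearMap.sum_apply, LinearMap.smul_apply, WithLp.ofLp_sum, WithLp.ofLp_smul,
    Finset.sum_apply, Pi.smul_apply]
  rw [Finset.sum_eq_single q, Finset.sum_eq_single φ]
  · simp [tensorBasis_apply, matrixUnit_apply]
  · intro ψ _ h
    obtain ⟨x, hx⟩ := Function.ne_iff.1 h
    rw [tensorBasis_apply q, tensorOp_pureTensor, Finset.prod_eq_zero (Finset.mem_univ x),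
      smul_zero]
    simp [matrixUnit_apply, hx]
  · simp
  · intro p _ h
    obtain ⟨x, hx⟩ := Function.ne_iff.1 h
    refine Finset.sum_eq_zero fun ψ _ => ?_
    rw [tensorBasis_apply q, tensorOp_pureTensor, Finset.prod_eq_zero (Finset.mem_univ x),
      smul_zero]
    simp [matrixUnit_apply, hx]
  · simp

end Tensor

/-! ### Intertwiners of the base group `F^X` -/

section Averaging

variable {F Y : Type*} [Group F] [Fintype F] [MulAction F Y]

/-- The projection of an operator onto the intertwining operators, by averaging. -/
noncomputable def average {W : Type*} [AddCommGroup W] [Module ℂ W] (σ : Representation ℂ F W)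
    (A : W →ₗ[ℂ] L Y) : σ.IntertwiningMap (permRep F Y) :=
  LinearMap.intertwiningMap_of_isIntertwiningMap _ _
    ((Fintype.card F : ℂ)⁻¹ • ∑ a, permRep F Y a⁻¹ ∘ₗ A ∘ₗ σ a) fun g v => by
      simp only [LinearMap.smul_apply, LinearMap.sum_apply, LinearMap.comp_apply, map_smul, map_sum]
      congr 1
      refine Fintype.sum_equiv (Equiv.mulRight g) _ _ fun a => ?_
      rw [← Module.End.mul_apply, ← Module.End.mul_apply, ← map_mul, ← map_mul]
      simp

theorem average_apply {W : Type*} [AddCommGroup W] [Module ℂ W] (σ : Representation ℂ F W)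
    (A : W →ₗ[ℂ] L Y) (v : W) (y : Y) :
    average σ A v y = (Fintype.card F : ℂ)⁻¹ * ∑ a, A (σ a v) (a • y) := by
  change ((Fintype.card F : ℂ)⁻¹ • ∑ a, permRep F Y a⁻¹ ∘ₗ A ∘ₗ σ a) v y = _
  simp

variable {X : Type*} [Fintype X] [DecidableEq X] [Fintype Y] {V : X → Type*}
  [∀ x, NormedAddCommGroup (V x)] [∀ x, InnerProductSpace ℂ (V x)]
  [∀ x, FiniteDimensional ℂ (V x)] (σ : ∀ x, Representation ℂ F (V x))

/-- The operators intertwining the outer tensor product of the `σ x` with `L(Y^X)` are spanned by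
the decomposable ones. -/
theorem eq_sum_tensorOp_of_intertwining {κ : X → Type*} [∀ x, Fintype (κ x)]
    (T : ∀ x, Module.Basis (κ x) ℂ ((σ x).IntertwiningMap (permRep F Y)))
    (B : TensorSpace V →ₗ[ℂ] L (X → Y))
    (hB : ∀ (f : X → F) (v : ∀ x, V x) (φ : X → Y),
      B (pureTensor fun x => σ x (f x) (v x)) (fun x => f x • φ x) = B (pureTensor v) φ) :
    ∃ a : (∀ x, κ x) → ℂ, B = ∑ j, a j • tensorOp fun x => (T x (j x)).toLinearMap := by
  classical
  let E (p : ∀ x, Fin (Module.finrank ℂ (V x))) (ψ : X → Y) (x : X) :=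
    average (σ x) (matrixUnit (W := V x) (p x) (ψ x))
  -- Replace `B` by its mean over `F^X` and expand it in matrix units inside the mean.
  have h1 : B = ∑ p : ∀ x, Fin (Module.finrank ℂ (V x)), ∑ ψ : X → Y,
      B (tensorBasis V p) ψ • tensorOp fun x => (E p ψ x).toLinearMap := by
    refine tensorSpace_ext fun v => ?_
    ext φ
    have hF : (Fintype.card (X → F) : ℂ) ≠ 0 := by
      exact_mod_cast Fintype.card_ne_zero
    have h2 : B (pureTensor v) φ = (Fintype.card (X → F) : ℂ)⁻¹ * ∑ f : X → F,
        B (pureTensor fun x => σ x (f x) (v x)) (fun x => f x • φ x) := by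
      simp only [hB, Finset.sum_const, Finset.card_univ, nsmul_eq_mul]
      rw [inv_mul_cancel_left₀ hF]
    rw [h2]
    conv_lhs => rw [eq_sum_tensorOp B]
    simp only [LinearMap.sum_apply, LinearMap.smul_apply, WithLp.ofLp_sum, WithLp.ofLp_smul,
      Finset.sum_apply, Pi.smul_apply, tensorOp_pureTensor, smul_eq_mul]
    rw [Finset.sum_comm, Finset.mul_sum]
    refine Finset.sum_congr rfl fun p _ => ?_
    rw [Finset.sum_comm, Finset.mul_sum]
    refine Finset.sum_congr rfl fun ψ _ => ?_
    rw [← Finset.mul_sum, mul_left_comm]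
    congr 1
    simp only [IntertwiningMap.toLinearMap_apply, E, average_apply]
    -- A product over `x` of sums over `F` is a sum over `F^X`, so averaging each factor separately
    -- is the same as averaging the tensor product.
    rw [Finset.prod_mul_distrib, Fintype.prod_sum]
    simp
  -- Each averaged factor expands in the basis `T x`; multilinearity does the rest.
  have h3 : ∀ p ψ, (tensorOp fun x => (E p ψ x).toLinearMap) =
      ∑ j : ∀ x, κ x, (∏ x, (T x).repr (E p ψ x) (j x)) •
        tensorOp fun x => (T x (j x)).toLinearMap := by
    intro p ψ
    refine tensorSpace_ext fun v => ?_
    ext φ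
    simp only [LinearMap.sum_apply, LinearMap.smul_apply, WithLp.ofLp_sum, WithLp.ofLp_smul,
      Finset.sum_apply, Pi.smul_apply, tensorOp_pureTensor, smul_eq_mul,
      ← Finset.prod_mul_distrib]
    rw [← Fintype.prod_sum fun x k => (T x).repr (E p ψ x) k * (T x k).toLinearMap (v x) (φ x)]
    refine Finset.prod_congr rfl fun x _ => ?_
    conv_lhs => rw [← (T x).sum_repr (E p ψ x)]
    simp only [IntertwiningMap.toLinearMap_apply, IntertwiningMap.sum_apply,
      IntertwiningMap.smul_apply, WithLp.ofLp_sum, WithLp.ofLp_smul, Finset.sum_apply,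
      Pi.smul_apply, smul_eq_mul]
  refine ⟨fun j => ∑ p, ∑ ψ, B (tensorBasis V p) ψ * ∏ x, (T x).repr (E p ψ x) (j x), ?_⟩
  refine h1.trans ?_
  simp only [h3, Finset.smul_sum, Finset.sum_smul, smul_smul]
  rw [Finset.sum_congr rfl fun p _ => Finset.sum_comm, Finset.sum_comm]

end Averaging

/-- As a fixed-point condition under conjugation, the intertwining property can be carried through
`conj_kernelOp` in both directions. -/
theorem intertwining_iff_conj {H V W : Type*} [Group H] [AddCommGroup V] [Module ℂ V]
    [AddCommGroup W] [Module ℂ W] (ρ : Representation ℂ H V) (τ : Representation ℂ H W)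
    (A : V →ₗ[ℂ] W) (h : H) : A ∘ₗ ρ h = τ h ∘ₗ A ↔ τ h⁻¹ ∘ₗ A ∘ₗ ρ h = A := by
  constructor
  · intro hA
    rw [hA, ← LinearMap.comp_assoc, ← Module.End.mul_eq_comp, ← map_mul]
    simp [Module.End.one_eq_id]
  · intro hA
    conv_rhs => rw [← hA]
    rw [← LinearMap.comp_assoc (A ∘ₗ ρ h), ← Module.End.mul_eq_comp, ← map_mul]
    simp [Module.End.one_eq_id]

/-! ### The lift `kernelOp` and its slices -/

section Kernel

variable {W U Q Z J : Type*} [Fintype J] [AddCommGroup W] [Module ℂ W] [AddCommGroup U] [Module ℂ U]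

/-- The operator `w ⊗ u ↦ ((q, z) ↦ ∑ j, (S u)(z, j) (A_j w)(q))`. -/
noncomputable def kernelOp (A : J → W →ₗ[ℂ] L Q) (S : U →ₗ[ℂ] L (Z × J)) :
    W ⊗[ℂ] U →ₗ[ℂ] L (Q × Z) :=
  (WithLp.linearEquiv 2 ℂ (Q × Z → ℂ)).symm.toLinearMap ∘ₗ
    LinearMap.pi fun p : Q × Z => ∑ j, LinearMap.mul' ℂ ℂ ∘ₗ TensorProduct.map
      (LinearMap.proj p.1 ∘ₗ (WithLp.linearEquiv 2 ℂ (Q → ℂ)).toLinearMap ∘ₗ A j)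
      (LinearMap.proj (p.2, j) ∘ₗ (WithLp.linearEquiv 2 ℂ (Z × J → ℂ)).toLinearMap ∘ₗ S)

@[simp]
theorem kernelOp_tmul (A : J → W →ₗ[ℂ] L Q) (S : U →ₗ[ℂ] L (Z × J)) (w : W) (u : U)
    (p : Q × Z) : kernelOp A S (w ⊗ₜ u) p = ∑ j, S u (p.2, j) * A j w p.1 := by
  simp [kernelOp, mul_comm]

theorem kernelOp_add (A : J → W →ₗ[ℂ] L Q) (S S' : U →ₗ[ℂ] L (Z × J)) :
    kernelOp A (S + S') = kernelOp A S + kernelOp A S' := by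
  refine TensorProduct.ext' fun w u => ?_
  ext p
  simp [add_mul, Finset.sum_add_distrib]

theorem kernelOp_smul (A : J → W →ₗ[ℂ] L Q) (a : ℂ) (S : U →ₗ[ℂ] L (Z × J)) :
    kernelOp A (a • S) = a • kernelOp A S := by
  refine TensorProduct.ext' fun w u => ?_
  ext p
  simp [mul_assoc, Finset.mul_sum]

/-- The operator `w ↦ (q ↦ M (w ⊗ u) (q, z))`, which is linear in `u`. -/
noncomputable def slice (M : W ⊗[ℂ] U →ₗ[ℂ] L (Q × Z)) (z : Z) : U →ₗ[ℂ] W →ₗ[ℂ] L Q :=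
  LinearMap.mk₂ ℂ (fun u w => WithLp.toLp 2 fun q => M (w ⊗ₜ u) (q, z))
    (fun u u' w => by ext q; simp [TensorProduct.tmul_add])
    (fun a u w => by ext q; simp)
    (fun u w w' => by ext q; simp [TensorProduct.add_tmul])
    (fun a u w => by ext q; simp [← TensorProduct.smul_tmul'])

@[simp]
theorem slice_apply (M : W ⊗[ℂ] U →ₗ[ℂ] L (Q × Z)) (z : Z) (u : U) (w : W) (q : Q) :
    slice M z u w q = M (w ⊗ₜ u) (q, z) := rfl

end Kernel

/-! ### Isometry and image of the lift -/

section KernelHilbertSchmidt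

variable {W U Q Z J : Type*} [Fintype J] [NormedAddCommGroup W] [InnerProductSpace ℂ W]
  [FiniteDimensional ℂ W] [NormedAddCommGroup U] [InnerProductSpace ℂ U] [Fintype Q]

section

variable [FiniteDimensional ℂ U] [Fintype Z]

/-- Summing over a basis of `W` and over `Q` first produces the products of `A j` with `A j'`.
Orthonormality leaves only `j = j'`, and the remaining sum over `z` and `j` is the scalar product of
`L(Z × J)`. -/
theorem hsInner_kernelOp [DecidableEq J] (A : J → W →ₗ[ℂ] L Q)
    (hA : ∀ j k, hsInner (A j) (A k) = if j = k then 1 else 0) (S S' : U →ₗ[ℂ] L (Z × J)) :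
    hsInner (kernelOp A S) (kernelOp A S') = hsInner S S' := by
  let b := stdOrthonormalBasis ℂ W
  let e := stdOrthonormalBasis ℂ U
  have h1 : hsInner (kernelOp A S) (kernelOp A S') = ∑ k, ∑ z, ∑ j, ∑ j',
      star (S (e k) (z, j)) * S' (e k) (z, j') * hsInner (A j) (A j') := by
    rw [hsInner_eq_sum (b.tensorProduct e), Fintype.sum_prod_type_right]
    refine Finset.sum_congr rfl fun k _ => ?_
    simp only [hsInner_L, Finset.mul_sum]
    have h2 : ∀ p, inner ℂ (kernelOp A S (b.tensorProduct e (p, k)))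
        (kernelOp A S' (b.tensorProduct e (p, k))) = ∑ z, ∑ q, ∑ j, ∑ j',
          star (S (e k) (z, j)) * S' (e k) (z, j') * (star (A j (b p) q) * A j' (b p) q) := by
      intro p
      rw [PiLp.inner_apply, Fintype.sum_prod_type_right]
      refine Finset.sum_congr rfl fun z _ => Finset.sum_congr rfl fun q _ => ?_
      rw [OrthonormalBasis.tensorProduct_apply, kernelOp_tmul, kernelOp_tmul]
      change (∑ j, _) * star (∑ j, _) = _
      rw [star_sum, mul_comm, Finset.sum_mul_sum]
      refine Finset.sum_congr rfl fun j _ => Finset.sum_congr rfl fun j' _ => ?_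
      rw [star_mul']
      ring
    simp only [h2]
    rw [Finset.sum_comm]
    refine Finset.sum_congr rfl fun z _ => ?_
    rw [Finset.sum_congr rfl fun p _ => Finset.sum_comm, Finset.sum_comm]
    refine Finset.sum_congr rfl fun j _ => ?_
    rw [Finset.sum_congr rfl fun p _ => Finset.sum_comm, Finset.sum_comm]
  rw [h1, hsInner_L]
  refine Finset.sum_congr rfl fun k _ => ?_
  rw [Fintype.sum_prod_type]
  simp [hA, e]

theorem kernelOp_injective [DecidableEq J] (A : J → W →ₗ[ℂ] L Q)
    (hA : ∀ j k, hsInner (A j) (A k) = if j = k then 1 else 0) :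
    Function.Injective (kernelOp (U := U) (Z := Z) A) := by
  intro S S' h
  have h0 : kernelOp A (S + (-1 : ℂ) • S') = 0 := by
    rw [kernelOp_add, kernelOp_smul, h]; simp
  have h1 := hsInner_self_eq_zero (S := S + (-1 : ℂ) • S') (by
    rw [← hsInner_kernelOp A hA, h0]; simp [hsInner])
  rw [neg_one_smul, ← sub_eq_add_neg] at h1
  exact sub_eq_zero.1 h1

end

/-- The coefficients of a slice are recovered by pairing it with the orthonormal `A j`; defined this
way they are visibly linear in `u`, which arbitrarily chosen coefficients would not be. -/
theorem exists_kernelOp_eq [DecidableEq J] (A : J → W →ₗ[ℂ] L Q)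
    (hA : ∀ j k, hsInner (A j) (A k) = if j = k then 1 else 0) (M : W ⊗[ℂ] U →ₗ[ℂ] L (Q × Z))
    (hM : ∀ u z, ∃ a : J → ℂ, slice M z u = ∑ j, a j • A j) : ∃ S, kernelOp A S = M := by
  let S : U →ₗ[ℂ] L (Z × J) :=
    { toFun := fun u => WithLp.toLp 2 fun p => hsInner (A p.2) (slice M p.1 u)
      map_add' := fun u u' => by ext p; simp [hsInner_add_right]
      map_smul' := fun a u => by ext p; simp [hsInner_smul_right] }
  refine ⟨S, TensorProduct.ext' fun w u => ?_⟩
  ext ⟨q, z⟩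
  obtain ⟨a, ha⟩ := hM u z
  have hS : ∀ j, S u (z, j) = a j := by
    intro j
    change hsInner (A j) (slice M z u) = _
    rw [ha]
    simp [hsInner_sum_right, hsInner_smul_right, hA]
  rw [kernelOp_tmul, ← slice_apply, ha]
  simp [hS]

end KernelHilbertSchmidt

/-! ### Equivariance under the wreath product -/

section Inertia

variable {F G X Y Z ι : Type*} [Group F] [Group G] [MulAction G X]
  [MulAction F Y] [MulAction G Z] {V : ι → Type*}
  [∀ i, NormedAddCommGroup (V i)] [∀ i, InnerProductSpace ℂ (V i)]
  {σ : ∀ i, Representation ℂ F (V i)} {c : X → ι} {m : ι → ℕ}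

/-- The operators `T_{x,h}` depend only on the block of `x`, so they do not see the identification
of `V_{σ_{g⁻¹x}}` with `V_{σ_x}`. -/
theorem apply_idOfEq
    (T : ∀ i, Fin (m i) → (σ i).IntertwiningMap (permRep F Y))
    {i k : ι} (h : i = k) (a : Fin (m k)) (b : Fin (m i))
    (hab : (a : ℕ) = b) (v : V i) : T k a (idOfEq V h v) = T i b v := by
  subst h
  obtain rfl : a = b := Fin.ext hab
  rfl

theorem IntertwiningMap.apply_smul {W : Type*} [AddCommGroup W] [Module ℂ W]
    {ρ : Representation ℂ F W} (S : ρ.IntertwiningMap (permRep F Y)) (f : F) (w : W) (y : Y) :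
    S (ρ f w) (f • y) = S w y := by
  rw [S.isIntertwining, permRep_apply, inv_smul_smul]

variable [PairwiseInequivalent σ]

theorem apply_pureTensor_inl {U : Type*} [AddCommGroup U] [Module ℂ U]
    (η : Representation ℂ (inertia G σ c) U)
    (M : ((extRep G σ c).tprod (inflation η)).IntertwiningMap
      (permRep (WreathProduct F (inertia G σ c) X) ((X → Y) × Z)))
    (f : X → F) (v : ∀ x, V (c x)) (u : U) (φ : X → Y) (z : Z) :
    M (pureTensor (fun x => σ (c x) (f x) (v x)) ⊗ₜ u) (fun x => f x • φ x, z) =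
      M (pureTensor v ⊗ₜ u) (φ, z) := by
  rw [← IntertwiningMap.apply_smul M (SemidirectProduct.inl f) (pureTensor v ⊗ₜ u) (φ, z)]
  rw [Representation.tprod_apply, TensorProduct.map_tmul, extRep_pureTensor, wreath_smul_def]
  have h : ∀ x y (_ : y = x) (h' : c y = c x), idOfEq V h' (v y) = v x := by
    rintro x _ rfl h'; rfl
  have h1 : (fun x => σ (c x) ((SemidirectProduct.inl f :
      WreathProduct F (inertia G σ c) X).left x)
      (idOfEq V (inertia_apply (SemidirectProduct.inl f :
        WreathProduct F (inertia G σ c) X).right⁻¹ x)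
        (v ((SemidirectProduct.inl f :
          WreathProduct F (inertia G σ c) X).right⁻¹ • x)))) =
      fun x => σ (c x) (f x) (v x) := by
    funext x
    rw [h x _ (by simp)]
    simp
  rw [h1]
  simp [inflation]

variable [Fintype X] (T : ∀ i, Fin (m i) → (σ i).IntertwiningMap (permRep F Y))

/-- The operator `T_j = ⊗_x T_{x, j x}`. -/
noncomputable def multiOp (c : X → ι) (j : MultiIndex m c) :
    TensorSpace (fun x => V (c x)) →ₗ[ℂ] L (X → Y) :=
  tensorOp fun x => (T (c x) (j x)).toLinearMap

/-- Write `w = (f, g)`. In each factor `f x` acts on both the vector and the point, and cancels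
because `T_{x,j(x)}` intertwines. Substituting `y = g⁻¹x` then leaves the index `j(g y)`, which is
`(g⁻¹j)(y)`. -/
theorem multiOp_extRep (w : WreathProduct F (inertia G σ c) X) (j : MultiIndex m c)
    (t : TensorSpace fun x => V (c x)) (p : (X → Y) × Z) :
    multiOp T c j (extRep G σ c w t) (w • p).1 = multiOp T c (w.right⁻¹ • j) t p.1 := by
  -- Evaluation as a linear functional turns the claim into an equality of linear maps, testable on
  -- pure tensors.
  let ev (φ : X → Y) : L (X → Y) →ₗ[ℂ] ℂ :=
    LinearMap.proj φ ∘ₗ (WithLp.linearEquiv 2 ℂ ((X → Y) → ℂ)).toLinearMap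
  suffices h : ev (w • p).1 ∘ₗ multiOp T c j ∘ₗ extRep G σ c w =
      ev p.1 ∘ₗ multiOp T c (w.right⁻¹ • j) from LinearMap.congr_fun h t
  refine tensorSpace_ext fun v => ?_
  change multiOp T c j (extRep G σ c w (pureTensor v)) (w • p).1 =
    multiOp T c (w.right⁻¹ • j) (pureTensor v) p.1
  rw [extRep_pureTensor, multiOp, multiOp, tensorOp_pureTensor, tensorOp_pureTensor]
  refine Fintype.prod_equiv (MulAction.toPerm w.right⁻¹) _ _ fun x => ?_
  rw [IntertwiningMap.toLinearMap_apply, IntertwiningMap.toLinearMap_apply, wreath_smul_def]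
  rw [IntertwiningMap.apply_smul]
  have h : ∀ y, y = x → ((j y : Fin _) : ℕ) = j x := by rintro _ rfl; rfl
  rw [apply_idOfEq T (inertia_apply w.right⁻¹ x) (j x) ((w.right⁻¹ • j) (w.right⁻¹ • x))
    (by rw [multiIndex_smul_apply]; exact (h (w.right⁻¹⁻¹ • w.right⁻¹ • x) (by simp)).symm)]
  rfl

variable [DecidableEq X] {U : Type*} [AddCommGroup U] [Module ℂ U]
  (η : Representation ℂ (inertia G σ c) U)

theorem conj_kernelOp (w : WreathProduct F (inertia G σ c) X)
    (S : U →ₗ[ℂ] L (Z × MultiIndex m c)) :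
    permRep (WreathProduct F (inertia G σ c) X) ((X → Y) × Z) w⁻¹ ∘ₗ
      kernelOp (multiOp T c) S ∘ₗ (extRep G σ c).tprod (inflation η) w =
    kernelOp (multiOp T c)
      (permRep (inertia G σ c) (Z × MultiIndex m c) w.right⁻¹ ∘ₗ S ∘ₗ η w.right) := by
  refine TensorProduct.ext' fun t u => ?_
  ext p
  simp only [LinearMap.comp_apply, permRep_apply, inv_inv, Representation.tprod_apply,
    TensorProduct.map_tmul, kernelOp_tmul, multiOp_extRep]
  -- The twist of `T_j` is absorbed by reindexing the sum over `J`, which moves the action onto the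
  -- kernel `S`.
  refine Fintype.sum_equiv (MulAction.toPerm w.right⁻¹) _ _ fun j => ?_
  change S (η w.right u) (w.right • p.2, j) * _ =
    S (η w.right u) (w.right • p.2, w.right • w.right⁻¹ • j) * _
  rw [smul_inv_smul]
  rfl

end Inertia

end WreathRep

theorem mainTheorem3
    {F G X Y Z ι : Type*} {V : ι → Type*} {U : Type*}
    [Group F] [Finite F] [Group G] [Finite G]
    [Fintype X] [DecidableEq X] [Fintype Y] [Fintype Z]
    [MulAction G X] [MulAction.IsPretransitive G X]
    [MulAction F Y] [MulAction.IsPretransitive F Y]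
    [MulAction G Z] [MulAction.IsPretransitive G Z]
    [∀ i, NormedAddCommGroup (V i)] [∀ i, InnerProductSpace ℂ (V i)]
    [∀ i, FiniteDimensional ℂ (V i)]
    [NormedAddCommGroup U] [InnerProductSpace ℂ U] [FiniteDimensional ℂ U]
    -- the irreducible, pairwise inequivalent, unitary representations `σ_i`, and the map `c` with
    -- `σ_x = σ_{c x}`; every `σ_x` occurs in `L(Y)`
    (σ : ∀ i, Representation ℂ F (V i)) [PairwiseInequivalent σ]
    (hσ : ∀ i, IsUnitary (σ i)) (hσ' : ∀ i, (σ i).IsIrreducible)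
    (c : X → ι) (m : ι → ℕ) (hm : ∀ x, 0 < m (c x))
    -- orthonormal bases `T_{i,1}, …, T_{i,m_i}` of `Hom_F(V_i, L(Y))`
    (T : ∀ i, Module.Basis (Fin (m i)) ℂ ((σ i).IntertwiningMap (permRep F Y)))
    (hT : ∀ i h k, hsInner (T i h).toLinearMap (T i k).toLinearMap = if h = k then 1 else 0)
    -- an irreducible unitary representation of the inertia group
    (η : Representation ℂ (inertia G σ c) U) (hη : IsUnitary η) (hη' : η.IsIrreducible) :
    ∃ Φ : η.IntertwiningMap (permRep (inertia G σ c) (Z × MultiIndex m c)) ≃ₗ[ℂ]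
        ((extRep G σ c).tprod (inflation η)).IntertwiningMap
          (permRep (WreathProduct F (inertia G σ c) X) ((X → Y) × Z)),
      (∀ (S : η.IntertwiningMap (permRep (inertia G σ c) (Z × MultiIndex m c)))
          (v : ∀ x, V (c x)) (u : U) (φ : X → Y) (z : Z),
        Φ S (pureTensor v ⊗ₜ[ℂ] u) (φ, z) =
          ∑ j : MultiIndex m c, S u (z, j) *
            tensorOp (fun x => (T (c x) (j x)).toLinearMap) (pureTensor v) φ) ∧
      ∀ S S' : η.IntertwiningMap (permRep (inertia G σ c) (Z × MultiIndex m c)),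
        hsInner (Φ S).toLinearMap (Φ S').toLinearMap = hsInner S.toLinearMap S'.toLinearMap := by
  classical
  have := Fintype.ofFinite F
  let A : MultiIndex m c → _ := multiOp (fun i => T i) c
  have hA : ∀ j k, hsInner (A j) (A k) = if j = k then 1 else 0 := by
    intro j k
    simp only [A, multiOp, hsInner_tensorOp, hT]
    exact prod_ite_eq_ite (κ := fun x => Fin (m (c x))) j k
  let Φ₀ : η.IntertwiningMap (permRep (inertia G σ c) (Z × MultiIndex m c)) →ₗ[ℂ]
      ((extRep G σ c).tprod (inflation η)).IntertwiningMap
        (permRep (WreathProduct F (inertia G σ c) X) ((X → Y) × Z)) :=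
    { toFun := fun S => ⟨kernelOp A S.toLinearMap, fun w => by
        rw [intertwining_iff_conj]
        refine (conj_kernelOp (fun i => T i) η w S.toLinearMap).trans ?_
        rw [(intertwining_iff_conj _ _ _ _).1 (S.isIntertwining' w.right)]⟩
      map_add' := fun S S' => Representation.IntertwiningMap.ext (kernelOp_add A _ _)
      map_smul' := fun a S => Representation.IntertwiningMap.ext (kernelOp_smul A a _) }
  have hinj : Function.Injective Φ₀ := fun S S' h =>
    Representation.IntertwiningMap.ext (kernelOp_injective A hA
      (congrArg Representation.IntertwiningMap.toLinearMap h))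
  have hsurj : Function.Surjective Φ₀ := by
    intro M
    obtain ⟨S, hS⟩ := exists_kernelOp_eq A hA M.toLinearMap fun u z =>
      eq_sum_tensorOp_of_intertwining (fun x => σ (c x)) (fun x => T (c x))
        (slice M.toLinearMap z u) fun f v φ => apply_pureTensor_inl η M f v u φ z
    refine ⟨⟨S, fun g => ?_⟩, Representation.IntertwiningMap.ext hS⟩
    rw [intertwining_iff_conj]
    -- Equivariance of `S` is checked after lifting, where conjugation by `(1, g)` fixes `M`.
    apply kernelOp_injective A hA
    have hM := (intertwining_iff_conj _ _ M.toLinearMap (SemidirectProduct.inr g)).1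
      (M.isIntertwining' _)
    refine (conj_kernelOp (fun i => T i) η (SemidirectProduct.inr g) S).symm.trans ?_
    exact (congrArg (fun N => permRep _ _ _ ∘ₗ N ∘ₗ _) hS).trans (hM.trans hS.symm)
  exact ⟨LinearEquiv.ofBijective Φ₀ ⟨hinj, hsurj⟩,
    fun S v u φ z => kernelOp_tmul A S.toLinearMap (pureTensor v) u (φ, z),
    fun S S' => hsInner_kernelOp A hA _ _⟩
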